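/- Let $G$ be a finite simple graph with non-empty vertex set $X$. Its Lovász theta function is $$\vartheta(G)=\max\{\operatorname{tr}(BJ) : B \text{ a real } X\times X \text{ matrix},\ B\succeq 0,\ \operatorname{tr}B=1,\ B_{xx'}=0 \text{ for every edge } xx'\},$$ where $J$ is the all-ones matrix. Let $N$ be a classical channel with finite input set $X$, output set $Y$ and transition probabilities $p(y|x)$. Its confusability graph has vertex set $X$, and distinct $x,x'$ are adjacent if some $y\in Y$ has $p(y|x)\neq 0$ and $p(y|x')\neq 0$. Let $\alpha^*(N)$ be the maximum number $m$ for which there are a unit vector $|\psi\rangle\in\mathbb C^{d_A}\otimes\mathbb C^{d_B}$ (for some finite $d_A,d_B$), POVMs $\{P^i_x : x\in X\}$ on $\mathbb C^{d_A}$ for $1\le i\le m$, and POVMs $\{Q^y_j : 1\le j\le m\}$ on $\mathbb C^{d_B}$ for $y\in Y$, such that $$\langle\psi|P^i_x\otimes Q^y_j|\psi\rangle=0\quad\text{whenever } i\ne j \text{ and } p(y|x)\neq 0 .$$ The entanglement-assisted one-shot zero-error number $\alpha^*(G)$ is this number for the channel whose outputs are the edges and the isolated vertices of $G$, where an input $x$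 yields each edge containing $x$ with non-zero probability, and an isolated vertex yields itself. The strong (tensor) product $G\otimes H$ of two graphs has as vertices the pairs of vertices; distinct $(x,w)$, $(x',w')$ are adjacent if $x,x'$ are equal or adjacent in $G$ and $w,w'$ are equal or adjacent in $H$. $G^{\otimes k}$ is the $k$-fold product, on $X^k$, and $N^{\otimes k}$ denotes $k$ independent uses of $N$. **Theorem 1.** The maxima defining $\vartheta(G)$ and $\alpha^*(G)$ exist, and $$\alpha^*(G)\le\vartheta(G).$$ Moreover $\vartheta(G\otimes H)=\vartheta(G)\,\vartheta(H)$ for every finite graph $H$ with non-empty vertex set, and the entanglement-assisted zero-error capacity is bounded by $\log_2\vartheta(G)$: the limit exists and $$\lim_{k\to\infty}\tfrac1k\log_2\alpha^*(G^{\otimes k})\le\log_2\vartheta(G).$$ Likewise, for every classical channel $N$ with confusability graph $G$, the maximum defining $\alpha^*(N)$ exists, $\alpha^*(N)\le\vartheta(G)$, the limit $\lim_{k\to\infty}\frac1k\log_2\alpha^*(N^{\otimes k})$ exists, and it is at most $\log_2\vartheta(G)$. -/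

import Mathlib

open scoped Kronecker Matrix ComplexOrder

/-- The relation `R x y` means: output `y` occurs with non-zero probability when `x` is the input.
An entanglement-assisted one-shot zero-error protocol for `m` messages: Alice and Bob share a pure
state `ψ` on `ℂ^dA ⊗ ℂ^dB`; on message `i` Alice measures the POVM `P i` and sends the outcome
`x`; on output `y` Bob measures the POVM `Q y`, and never obtains a message other than `i`. -/
structure EAProtocol {X Y : Type*} [Fintype X] (R : X → Y → Prop) (m : ℕ) where
  dA : ℕ
  dB : ℕ
  ψ : Fin dA × Fin dB → ℂ
  P : Fin m → X → Matrix (Fin dA) (Fin dA) ℂ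
  Q : Y → Fin m → Matrix (Fin dB) (Fin dB) ℂ
  unit : star ψ ⬝ᵥ ψ = 1
  P_pos : ∀ i x, (P i x).PosSemidef
  P_sum : ∀ i, ∑ x, P i x = 1
  Q_pos : ∀ y j, (Q y j).PosSemidef
  Q_sum : ∀ y, ∑ j, Q y j = 1
  zero_error : ∀ i x y j, R x y → i ≠ j → star ψ ⬝ᵥ ((P i x ⊗ₖ Q y j) *ᵥ ψ) = 0

/-- The numbers of messages that can be sent in one shot, with entanglement and no error. -/
def eaSizes {X Y : Type*} [Fintype X] (R : X → Y → Prop) : Set ℕ :=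
  {m | Nonempty (EAProtocol R m)}

/-- The largest number of messages that can be sent in one shot, with entanglement and no error. -/
noncomputable def eaNumber {X Y : Type*} [Fintype X] (R : X → Y → Prop) : ℕ :=
  sSup (eaSizes R)

/-- The outputs of the channel attached to a graph: its edges and its isolated vertices. -/
abbrev EdgeOutput {X : Type*} (G : SimpleGraph X) : Type _ :=
  {e : Sym2 X // e ∈ G.edgeSet} ⊕ {v : X // ∀ x, ¬ G.Adj v x}

/-- The channel attached to a graph: a vertex may produce any edge that contains it, and an
isolated vertex produces itself. -/
def edgeOutputs {X : Type*} (G : SimpleGraph X) (x : X) : EdgeOutput G → Prop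
  | Sum.inl e => x ∈ e.1
  | Sum.inr v => x = v.1

/-- The entanglement-assisted one-shot zero-error number `α*(G)`. -/
noncomputable def alphaStar {X : Type*} [Fintype X] (G : SimpleGraph X) : ℕ :=
  eaNumber (edgeOutputs G)

/-- The strong (tensor) product of two graphs. -/
def strongProd {X W : Type*} (G : SimpleGraph X) (H : SimpleGraph W) : SimpleGraph (X × W) where
  Adj a b := a ≠ b ∧ (a.1 = b.1 ∨ G.Adj a.1 b.1) ∧ (a.2 = b.2 ∨ H.Adj a.2 b.2)
  symm := ⟨fun _ _ h => ⟨h.1.symm, h.2.1.imp Eq.symm fun e => e.symm,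
    h.2.2.imp Eq.symm fun e => e.symm⟩⟩
  loopless := ⟨fun _ h => h.1 rfl⟩

/-- The `k`-fold strong (tensor) power of a graph. -/
def strongPow {X : Type*} (G : SimpleGraph X) (k : ℕ) : SimpleGraph (Fin k → X) where
  Adj a b := a ≠ b ∧ ∀ i, a i = b i ∨ G.Adj (a i) (b i)
  symm := ⟨fun _ _ h => ⟨h.1.symm, fun i => (h.2 i).imp Eq.symm fun e => e.symm⟩⟩
  loopless := ⟨fun _ h => h.1 rfl⟩

/-- The values `tr (B J)` over the feasible matrices `B` of the theta program. -/
def thetaValues {X : Type*} [Fintype X] (G : SimpleGraph X) : Set ℝ :=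
  {t | ∃ B : Matrix X X ℝ, B.PosSemidef ∧ B.trace = 1 ∧ (∀ x x', G.Adj x x' → B x x' = 0) ∧
    t = (B * Matrix.of fun _ _ => 1).trace}

/-- The Lovász theta function. -/
noncomputable def lovaszTheta {X : Type*} [Fintype X] (G : SimpleGraph X) : ℝ :=
  sSup (thetaValues G)

/-- The confusability graph of a channel; `N x y` is the probability of output `y` on input `x`. -/
def confusabilityGraph {X Y : Type*} (N : X → PMF Y) : SimpleGraph X where
  Adj x x' := x ≠ x' ∧ ∃ y, N x y ≠ 0 ∧ N x' y ≠ 0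
  symm := ⟨fun _ _ h => ⟨h.1.symm, h.2.imp fun _ e => e.symm⟩⟩
  loopless := ⟨fun _ h => h.1 rfl⟩

/-- Helper: the product of `k` probability mass functions has total mass one. -/
theorem tsum_prod_pmf {Y : Type*} : ∀ (k : ℕ) (p : Fin k → PMF Y),
    ∑' y : Fin k → Y, ∏ i, p i (y i) = 1
  | 0, p => by simp
  | k + 1, p => by
    rw [← (Fin.consEquiv fun _ : Fin (k + 1) => Y).tsum_eq]
    simp only [Fin.consEquiv_apply, Fin.prod_univ_succ, Fin.cons_zero, Fin.cons_succ]
    rw [ENNReal.tsum_prod (f := fun (a : Y) (b : Fin k → Y) => p 0 a * ∏ i : Fin k, p i.succ (b i))]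
    simp only [ENNReal.tsum_mul_left, tsum_prod_pmf k fun i => p i.succ, mul_one, PMF.tsum_coe]

/-- `k` independent (memoryless) uses of a channel. -/
noncomputable def channelPow {X Y : Type*} (N : X → PMF Y) (k : ℕ) :
    (Fin k → X) → PMF (Fin k → Y) :=
  fun x => ⟨fun y => ∏ i, N (x i) (y i),
    (tsum_prod_pmf k fun i => N (x i)) ▸ ENNReal.summable.hasSum⟩

/-- The input–output pairs of a channel that have non-zero probability. -/
def channelOutputs {X Y : Type*} (N : X → PMF Y) (x : X) (y : Y) : Prop := N x y ≠ 0

/-- The entanglement-assisted one-shot zero-error number of a channel. -/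
noncomputable def channelAlphaStar {X Y : Type*} [Fintype X] (N : X → PMF Y) : ℕ :=
  eaNumber (channelOutputs N)

/-- `C = lim (1/k) log₂ a k` as `k → ∞`. -/
def IsRate (a : ℕ → ℕ) (C : ℝ) : Prop :=
  Filter.Tendsto (fun k : ℕ => (1 / (k : ℝ)) * Real.logb 2 (a k)) Filter.atTop (nhds C)

/-! ### The theta program: compactness and attainment. -/

section Theta

variable {X W : Type*} [Fintype X] [Fintype W]

/-! Bob can be eliminated. Zero error means that the states of Bob steered by distinct messages
through equal or confusable inputs are orthogonal. In terms of Alice's reduced state `σ` and her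
measurements this reads `P i x * σ * P j y = 0`. Conversely, such orthogonality lets Bob
discriminate perfectly (`EAProtocol.graphCode`, `GraphCode.protocol`). The achievable sizes
therefore depend only on the confusability graph (`eaSizes_eq`).

For the bound (`GraphCode.card_le_lovaszTheta`), each of the `m` measurements is dilated to
orthogonal projections. The sum over messages of the projections for input `x`, applied to a
purification of `σ`, gives a vector for `x`. In the Gram matrix of these vectors, terms with
distinct messages vanish on edges and on the diagonal by orthogonality of the code. Terms with equal
messages vanish on edges because the dilated measurement is projective. Its trace is `m`, and its
entries sum to `m ^ 2` because each measurement sums to the identity. Divided by `m`, its real part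
is feasible for theta with value `m`.

Multiplicativity is duality: Kronecker products of primal points and of dual points
(`exists_isThetaDual`) are again feasible. Product codes make `log α*` of the powers superadditive,
so Fekete's lemma gives the limit, and multiplicativity bounds it. -/

theorem Matrix.PosSemidef.exists_eq_conjTranspose_mul {n 𝕜 : Type*} [RCLike 𝕜] [Fintype n]
    {A : Matrix n n 𝕜} (hA : A.PosSemidef) : ∃ S : Matrix n n 𝕜, A = Sᴴ * S := by
  open scoped MatrixOrder in
  classical
  exact CStarAlgebra.nonneg_iff_eq_star_mul_self.mp hA.nonneg

theorem posSemidef_real_iff {B : Matrix X X ℝ} :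
    B.PosSemidef ↔ (∀ x y, B x y = B y x) ∧ ∀ v : X → ℝ, 0 ≤ ∑ x, ∑ y, v x * B x y * v y := by
  rw [Matrix.posSemidef_iff_dotProduct_mulVec]
  refine and_congr ⟨fun h x y => ?_, fun h => ?_⟩ (forall_congr' fun v => ?_)
  · simpa using (h.apply x y).symm
  · ext x y; simpa using h y x
  · simp [dotProduct, Matrix.mulVec, Finset.mul_sum, mul_assoc]

theorem trace_mul_allOnes (B : Matrix X X ℝ) :
    (B * Matrix.of fun _ _ => 1).trace = ∑ x, ∑ y, B x y := by
  simp [Matrix.trace, Matrix.mul_apply]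

/-- The real density matrices. -/
def realDensityMatrices (X : Type*) [Fintype X] : Set (Matrix X X ℝ) :=
  {B | B.PosSemidef ∧ B.trace = 1}

/-- The quadratic form at `e_x ± e_y` gives `2 |B x y| ≤ B x x + B y y`. This puts the density
matrices in a compact box. -/
theorem Matrix.PosSemidef.abs_apply_le_trace {B : Matrix X X ℝ} (hB : B.PosSemidef) (x y : X) :
    |B x y| ≤ B.trace := by
  have hle : ∀ z, B z z ≤ B.trace := fun z =>
    Finset.single_le_sum (f := fun z => B z z) (fun i _ => hB.diag_nonneg) (Finset.mem_univ z)
  obtain ⟨S, hS⟩ := hB.exists_eq_conjTranspose_mul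
  have hxy : ∀ a b, B a b = ∑ z, S z a * S z b := fun a b => by
    rw [hS]; simp [Matrix.mul_apply]
  have h1 : 0 ≤ ∑ z, (S z x + S z y) ^ 2 := Finset.sum_nonneg fun z _ => sq_nonneg _
  have h2 : 0 ≤ ∑ z, (S z x - S z y) ^ 2 := Finset.sum_nonneg fun z _ => sq_nonneg _
  have e1 : ∑ z, (S z x + S z y) ^ 2 = B x x + 2 * B x y + B y y := by
    simp only [hxy, Finset.mul_sum, ← Finset.sum_add_distrib]
    exact Finset.sum_congr rfl fun z _ => by ring
  have e2 : ∑ z, (S z x - S z y) ^ 2 = B x x - 2 * B x y + B y y := by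
    simp only [hxy, Finset.mul_sum, ← Finset.sum_add_distrib, ← Finset.sum_sub_distrib]
    exact Finset.sum_congr rfl fun z _ => by ring
  have := hle x
  have := hle y
  rw [abs_le]
  constructor <;> linarith

theorem isCompact_realDensityMatrices : IsCompact (realDensityMatrices X) := by
  have hbox : IsCompact (Set.pi Set.univ fun _ : X => Set.pi Set.univ fun _ : X =>
      Set.Icc (-1 : ℝ) 1) :=
    isCompact_univ_pi fun _ => isCompact_univ_pi fun _ => isCompact_Icc
  refine hbox.of_isClosed_subset ?_ ?_
  · have : realDensityMatrices X = (⋂ x : X, ⋂ y : X, {B : Matrix X X ℝ | B x y = B y x}) ∩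
        (⋂ v : X → ℝ, {B : Matrix X X ℝ | 0 ≤ ∑ x, ∑ y, v x * B x y * v y}) ∩
        {B : Matrix X X ℝ | ∑ x, B x x = 1} := by
      ext B
      simp [realDensityMatrices, posSemidef_real_iff, Matrix.trace]
    rw [this]
    have hc : ∀ x y : X, Continuous fun B : Matrix X X ℝ => B x y := fun x y =>
      (continuous_apply y).comp (continuous_apply x)
    refine ((isClosed_iInter fun x => isClosed_iInter fun y =>
      isClosed_eq (hc x y) (hc y x)).inter (isClosed_iInter fun v => isClosed_le continuous_const
        ?_)).inter (isClosed_eq ?_ continuous_const)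
    · exact continuous_finsetSum _ fun x _ => continuous_finsetSum _ fun y _ =>
        (continuous_const.mul (hc x y)).mul continuous_const
    · exact continuous_finsetSum _ fun x _ => hc x x
  · rintro B ⟨hB, ht⟩ x - y -
    have := hB.abs_apply_le_trace x y
    rw [ht] at this
    exact abs_le.mp this

theorem convex_realDensityMatrices : Convex ℝ (realDensityMatrices X) := by
  rintro A ⟨hA, hA'⟩ B ⟨hB, hB'⟩ a b ha hb hab
  refine ⟨(hA.smul ha).add (hB.smul hb), ?_⟩
  simp [Matrix.trace_add, Matrix.trace_smul, hA', hB', hab]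

theorem one_mem_thetaValues [Nonempty X] (G : SimpleGraph X) : (1 : ℝ) ∈ thetaValues G := by
  classical
  obtain ⟨a⟩ := ‹Nonempty X›
  refine ⟨Matrix.diagonal (Pi.single a 1), ?_, ?_, ?_, ?_⟩
  · rw [Matrix.posSemidef_diagonal_iff]
    intro i
    by_cases h : i = a
    · subst h; simp
    · simp [h]
  · simp [Matrix.trace]
  · intro x y h
    exact Matrix.diagonal_apply_ne _ h.ne
  · simp [trace_mul_allOnes, Matrix.diagonal_apply]

theorem isGreatest_lovaszTheta [Nonempty X] (G : SimpleGraph X) :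
    IsGreatest (thetaValues G) (lovaszTheta G) := by
  have hc : ∀ x y : X, Continuous fun B : Matrix X X ℝ => B x y := fun x y =>
    (continuous_apply y).comp (continuous_apply x)
  have hK : IsCompact (realDensityMatrices X ∩
      ⋂ x : X, ⋂ y : X, ⋂ _ : G.Adj x y, {B : Matrix X X ℝ | B x y = 0}) :=
    isCompact_realDensityMatrices.inter_right (isClosed_iInter fun x => isClosed_iInter fun y =>
      isClosed_iInter fun _ => isClosed_eq (hc x y) continuous_const)
  have himage : thetaValues G = (fun B : Matrix X X ℝ => ∑ x, ∑ y, B x y) '' (realDensityMatrices X ∩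
      ⋂ x : X, ⋂ y : X, ⋂ _ : G.Adj x y, {B : Matrix X X ℝ | B x y = 0}) := by
    ext t
    constructor
    · rintro ⟨B, h1, h2, h3, h4⟩
      exact ⟨B, ⟨⟨h1, h2⟩, by simpa using h3⟩, by rw [h4, trace_mul_allOnes]⟩
    · rintro ⟨B, ⟨⟨h1, h2⟩, h3⟩, h4⟩
      exact ⟨B, h1, h2, by simpa using h3, by rw [trace_mul_allOnes]; exact h4.symm⟩
  have hcomp : IsCompact (thetaValues G) := by
    rw [himage]
    exact hK.image (continuous_finsetSum _ fun x _ => continuous_finsetSum _ fun y _ => hc x y)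
  exact hcomp.isGreatest_sSup ⟨1, one_mem_thetaValues G⟩

theorem one_le_lovaszTheta [Nonempty X] (G : SimpleGraph X) : 1 ≤ lovaszTheta G :=
  (isGreatest_lovaszTheta G).2 (one_mem_thetaValues G)

theorem sum_le_lovaszTheta [Nonempty X] {G : SimpleGraph X} {B : Matrix X X ℝ} (hB : B.PosSemidef)
    (ht : B.trace = 1) (hG : ∀ x y, G.Adj x y → B x y = 0) :
    ∑ x, ∑ y, B x y ≤ lovaszTheta G :=
  (isGreatest_lovaszTheta G).2 ⟨B, hB, ht, hG, (trace_mul_allOnes B).symm⟩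

theorem exists_optimal_lovaszTheta [Nonempty X] (G : SimpleGraph X) :
    ∃ B : Matrix X X ℝ, B.PosSemidef ∧ B.trace = 1 ∧ (∀ x y, G.Adj x y → B x y = 0) ∧
      ∑ x, ∑ y, B x y = lovaszTheta G := by
  obtain ⟨B, h1, h2, h3, h4⟩ := (isGreatest_lovaszTheta G).1
  exact ⟨B, h1, h2, h3, by rw [h4, trace_mul_allOnes]⟩

/-! ### Duality for the theta program. -/

/-- A feasible point of the dual of the theta program: `M` is `t` on the diagonal and zero off the
edges, and dominates the all-ones matrix. -/
structure IsThetaDual (G : SimpleGraph X) (t : ℝ) (M : Matrix X X ℝ) : Prop where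
  diag : ∀ x, M x x = t
  zero : ∀ x y, x ≠ y → ¬ G.Adj x y → M x y = 0
  pos : (M - Matrix.of fun _ _ => 1).PosSemidef

theorem Matrix.PosSemidef.sum_mul_nonneg {A B : Matrix X X ℝ} (hA : A.PosSemidef)
    (hB : B.PosSemidef) : 0 ≤ ∑ x, ∑ y, A x y * B x y := by
  obtain ⟨S, rfl⟩ := hA.exists_eq_conjTranspose_mul
  have hq := (posSemidef_real_iff.mp hB).2
  have : ∑ x, ∑ y, (Sᴴ * S) x y * B x y = ∑ z, ∑ x, ∑ y, S z x * B x y * S z y := by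
    simp only [Matrix.mul_apply, Matrix.conjTranspose_apply, star_trivial, Finset.sum_mul]
    rw [Finset.sum_comm]
    conv_rhs => rw [Finset.sum_comm, Finset.sum_congr rfl fun x _ => Finset.sum_comm]
    rw [Finset.sum_comm]
    exact Finset.sum_congr rfl fun x _ => Finset.sum_congr rfl fun y _ =>
      Finset.sum_congr rfl fun z _ => by ring
  rw [this]
  exact Finset.sum_nonneg fun z _ => hq _

/-- Weak duality: `B` vanishes on edges and `M` off them, so only the diagonal contributes to `tr (B
M) = t`, while `tr (B (M - J)) ≥ 0`. -/
theorem IsThetaDual.lovaszTheta_le [Nonempty X] {G : SimpleGraph X} {t : ℝ} {M : Matrix X X ℝ}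
    (hM : IsThetaDual G t M) : lovaszTheta G ≤ t := by
  obtain ⟨B, h1, h2, h3, h4⟩ := exists_optimal_lovaszTheta G
  have h := h1.sum_mul_nonneg hM.pos
  have e : ∑ x, ∑ y, B x y * M x y = t := by
    calc ∑ x, ∑ y, B x y * M x y = ∑ x, B x x * t := by
          refine Finset.sum_congr rfl fun x _ => ?_
          rw [Finset.sum_eq_single x, hM.diag]
          · intro y _ hy
            by_cases ha : G.Adj x y
            · rw [h3 x y ha, zero_mul]
            · rw [hM.zero x y hy.symm ha, mul_zero]
          · simp
      _ = t := by
          rw [← Finset.sum_mul]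
          have : ∑ x, B x x = 1 := h2
          rw [this, one_mul]
  simp only [Matrix.sub_apply, Matrix.of_apply, mul_sub, mul_one, Finset.sum_sub_distrib, e,
    h4] at h
  linarith

/-- Strong duality for the theta program, up to an arbitrarily small gap. -/
theorem exists_isThetaDual [Nonempty X] {G : SimpleGraph X} {t : ℝ} (ht : lovaszTheta G < t) :
    ∃ M : Matrix X X ℝ, IsThetaDual G t M := by
  classical
  -- `Φ` records the edge entries and the objective. The image of the density matrices is compact
  -- and convex and misses `{0} × [t, ∞)`, since `t` exceeds theta. A strictly separating functional
  -- supplies `M`.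
  let Φ : Matrix X X ℝ →ₗ[ℝ] (X → X → ℝ) × ℝ :=
    { toFun := fun B => (fun x y => if G.Adj x y then B x y else 0, ∑ x, ∑ y, B x y)
      map_add' := fun A B => by
        ext x
        · simp only [Prod.mk_add_mk, Pi.add_apply, Matrix.add_apply]; split_ifs <;> simp
        · simp [Finset.sum_add_distrib]
      map_smul' := fun c B => by
        ext x
        · simp
        · simp [Finset.mul_sum] }
  have hΦ : Continuous Φ := by
    have hc : ∀ x y : X, Continuous fun B : Matrix X X ℝ => B x y := fun x y =>
      (continuous_apply y).comp (continuous_apply x)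
    refine Continuous.prodMk (continuous_pi fun x => continuous_pi fun y => ?_)
      (continuous_finsetSum _ fun x _ => continuous_finsetSum _ fun y _ => hc x y)
    by_cases h : G.Adj x y
    · simpa [h] using hc x y
    · simpa [h] using continuous_const
  have hdisj : Disjoint (Φ '' realDensityMatrices X)
      (({0} : Set (X → X → ℝ)) ×ˢ Set.Ici t) := by
    rw [Set.disjoint_left]
    rintro _ ⟨B, ⟨hB, hB'⟩, rfl⟩ ⟨h1, h2⟩
    have h1 : (fun x y => if G.Adj x y then B x y else 0) = 0 := h1
    have h2 : t ≤ ∑ x, ∑ y, B x y := h2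
    have := sum_le_lovaszTheta (G := G) hB hB' fun x y hxy => by
      simpa [hxy] using congrFun (congrFun h1 x) y
    linarith
  obtain ⟨f, u, v, hu, huv, hv⟩ := geometric_hahn_banach_compact_closed
    (convex_realDensityMatrices.linear_image Φ) (isCompact_realDensityMatrices.image hΦ)
    ((convex_singleton _).prod (convex_Ici t)) (isClosed_singleton.prod isClosed_Ici) hdisj
  set s : ℝ := f (0, 1) with hs
  set g : X → X → ℝ := fun x y => f (Pi.single x (Pi.single y 1), 0) with hg
  have hf : ∀ Z r, f (Z, r) = (∑ x, ∑ y, Z x y * g x y) + r * s := by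
    intro Z r
    have h1 : (Z, r) = (∑ x, ∑ y, Z x y • ((Pi.single x (Pi.single y 1), 0) :
        (X → X → ℝ) × ℝ)) + r • ((0, 1) : (X → X → ℝ) × ℝ) := by
      ext a b
      · simp [Prod.fst_sum, Finset.sum_apply, Pi.single_apply]
      · simp [Prod.snd_sum]
    rw [h1]
    simp only [map_add, map_sum, map_smul, smul_eq_mul, hs, hg]
  have hray : ∀ r, t ≤ r → v < r * s := fun r hr => by
    simpa [hf] using hv (0, r) ⟨rfl, hr⟩
  have hden : ∀ B ∈ realDensityMatrices X,
      (∑ x, ∑ y, (if G.Adj x y then B x y else 0) * g x y) + (∑ x, ∑ y, B x y) * s < u :=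
    fun B hB => by
      rw [← hf]; exact hu _ ⟨B, hB, rfl⟩
  have ht1 : 1 < t := (one_le_lovaszTheta G).trans_lt ht
  -- At a feasible point of value 1 the edge part vanishes, so separation gives `s < t * s` with `1
  -- < t`.
  have hspos : 0 < s := by
    obtain ⟨B, h1, h2, h3, h4⟩ := one_mem_thetaValues G
    have hB := hden B ⟨h1, h2⟩
    rw [trace_mul_allOnes] at h4
    have h0 : ∑ x, ∑ y, (if G.Adj x y then B x y else 0) * g x y = 0 :=
      Finset.sum_eq_zero fun x _ => Finset.sum_eq_zero fun y _ => by
        by_cases h : G.Adj x y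
        · simp [h, h3 x y h]
        · simp [h]
    rw [h0, ← h4] at hB
    have := hray t le_rfl
    nlinarith
  let M : Matrix X X ℝ := Matrix.of fun x y => if x = y then t else
    if G.Adj x y then - (g x y + g y x) / (2 * s) else 0
  refine ⟨M, fun x => by simp [M], fun x y hxy ha => by simp [M, hxy, ha], ?_⟩
  rw [posSemidef_real_iff]
  refine ⟨fun x y => ?_, fun w => ?_⟩
  · simp only [M, Matrix.sub_apply, Matrix.of_apply, eq_comm (a := x), G.adj_comm x y,
      add_comm (g x y)]
  by_cases hw : w = 0
  · simp [hw]
  have hN : 0 < ∑ x, w x ^ 2 := by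
    obtain ⟨a, ha⟩ := Function.ne_iff.mp hw
    exact Finset.sum_pos' (fun _ _ => sq_nonneg _) ⟨a, Finset.mem_univ _, by
      have : w a ≠ 0 := ha
      positivity⟩
  set N := ∑ x, w x ^ 2 with hNdef
  -- The separation inequality at the projection onto `w`, divided by `s`, is positivity of the form
  -- of `M - J` at `w`.
  let B : Matrix X X ℝ := Matrix.of fun x y => N⁻¹ * (w x * w y)
  have hB : B ∈ realDensityMatrices X := by
    refine ⟨posSemidef_real_iff.mpr ⟨fun x y => ?_, fun z => ?_⟩, ?_⟩
    · simp only [B, Matrix.of_apply]; ring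
    · have : ∑ x, ∑ y, z x * B x y * z y = N⁻¹ * (∑ x, z x * w x) ^ 2 := by
        rw [sq, Finset.sum_mul_sum, Finset.mul_sum]
        refine Finset.sum_congr rfl fun x _ => ?_
        rw [Finset.mul_sum]
        exact Finset.sum_congr rfl fun y _ => by simp only [B, Matrix.of_apply]; ring
      rw [this]; positivity
    · simp only [Matrix.trace, Matrix.diag, B, Matrix.of_apply, ← Finset.mul_sum, ← sq, ← hNdef]
      exact inv_mul_cancel₀ hN.ne'
  have h1 := (hden B hB).trans (huv.trans (hray t le_rfl))
  set E := ∑ x, ∑ y, (if G.Adj x y then w x * w y else 0) * g x y with hE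
  set T := ∑ x, ∑ y, w x * w y with hT
  have e1 : ∑ x, ∑ y, (if G.Adj x y then B x y else 0) * g x y = N⁻¹ * E := by
    simp only [hE, Finset.mul_sum]
    refine Finset.sum_congr rfl fun x _ => Finset.sum_congr rfl fun y _ => ?_
    simp only [B, Matrix.of_apply]; split_ifs <;> ring
  have e2 : ∑ x, ∑ y, B x y = N⁻¹ * T := by
    simp only [hT, Finset.mul_sum, B, Matrix.of_apply]
  rw [e1, e2] at h1
  have h2 : E + T * s < N * (t * s) := by
    have := mul_lt_mul_of_pos_left h1 hN
    field_simp at this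
    linarith
  have hE' : ∑ x, ∑ y, (if G.Adj x y then w x * w y else 0) * g y x = E := by
    rw [hE, Finset.sum_comm]
    exact Finset.sum_congr rfl fun x _ => Finset.sum_congr rfl fun y _ => by
      rw [G.adj_comm, mul_comm (w y)]
  have hT' : ∑ x, w x * ∑ y, w y = T := by simp only [hT, Finset.mul_sum]
  have e3 : ∑ x, ∑ y, w x * (M - Matrix.of fun _ _ => 1 : Matrix X X ℝ) x y * w y = t * N - E / s - T := by
    have hterm : ∀ x y, w x * (M - Matrix.of fun _ _ => 1 : Matrix X X ℝ) x y * w y =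
        (if x = y then t * w x ^ 2 else 0) -
          ((if G.Adj x y then w x * w y else 0) * g x y
            + (if G.Adj x y then w x * w y else 0) * g y x) / (2 * s) - w x * w y := by
      intro x y
      by_cases hxy : x = y
      · subst hxy; simp [M]; ring
      · by_cases ha : G.Adj x y
        · simp [M, hxy, ha]; ring
        · simp [M, hxy, ha]
    simp only [hterm, Finset.sum_sub_distrib, ← Finset.sum_div, Finset.sum_add_distrib, hE',
      ← hE, Finset.sum_ite_eq, Finset.mem_univ, if_true, ← Finset.mul_sum, ← hNdef, hT']
    field_simp
    ring
  rw [e3]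
  have : E / s + T < N * t := by
    rw [div_add' _ _ _ hspos.ne', div_lt_iff₀ hspos]; linarith
  linarith

/-! ### Multiplicativity of theta. -/

theorem posSemidef_allOnes (X : Type*) [Fintype X] :
    (Matrix.of fun _ _ : X => (1 : ℝ)).PosSemidef := by
  refine posSemidef_real_iff.mpr ⟨fun _ _ => rfl, fun v => ?_⟩
  simp only [Matrix.of_apply, mul_one, ← Finset.sum_mul_sum]
  exact mul_self_nonneg _

theorem lovaszTheta_strongProd [Nonempty X] [Nonempty W] (G : SimpleGraph X) (H : SimpleGraph W) :
    lovaszTheta (strongProd G H) = lovaszTheta G * lovaszTheta H := by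
  apply le_antisymm
  · refine le_mul_of_forall_lt₀ fun t ht s hs => ?_
    obtain ⟨M, hM⟩ := exists_isThetaDual ht
    obtain ⟨K, hK⟩ := exists_isThetaDual hs
    refine IsThetaDual.lovaszTheta_le (M := M ⊗ₖ K) ⟨fun x => ?_, ?_, ?_⟩
    · simp [hM.diag, hK.diag]
    · rintro ⟨x, a⟩ ⟨y, b⟩ hne hadj
      simp only [strongProd, not_and_or, Matrix.kronecker_apply] at hadj ⊢
      rcases hadj with h | h | h
      · exact absurd hne h
      · push Not at h
        rw [hM.zero x y h.1 h.2, zero_mul]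
      · push Not at h
        rw [hK.zero a b h.1 h.2, mul_zero]
    · have hK' : K.PosSemidef := by simpa using hK.pos.add (posSemidef_allOnes W)
      -- Both summands are positive, because `K = (K - J) + J` is.
      have e : M ⊗ₖ K - Matrix.of (fun _ _ => 1) = (M - Matrix.of fun _ _ => 1) ⊗ₖ K +
          (Matrix.of fun _ _ => 1) ⊗ₖ (K - Matrix.of fun _ _ => 1) := by
        ext ⟨x, a⟩ ⟨y, b⟩
        simp [sub_mul]
      rw [e]
      exact (hM.pos.kronecker hK').add ((posSemidef_allOnes X).kronecker hK.pos)
  · obtain ⟨B, h1, h2, h3, h4⟩ := exists_optimal_lovaszTheta G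
    obtain ⟨C, k1, k2, k3, k4⟩ := exists_optimal_lovaszTheta H
    have := sum_le_lovaszTheta (G := strongProd G H) (h1.kronecker k1)
      (by rw [Matrix.trace_kronecker, h2, k2, one_mul]) (by
        rintro ⟨x, a⟩ ⟨y, b⟩ ⟨hne, hx, ha⟩
        simp only [Matrix.kronecker_apply]
        rcases hx with rfl | hx
        · rcases ha with rfl | ha
          · exact absurd rfl hne
          · rw [k3 a b ha, mul_zero]
        · rw [h3 x y hx, zero_mul])
    refine le_trans (le_of_eq ?_) this
    simp only [← h4, ← k4, Fintype.sum_prod_type, Matrix.kronecker_apply, Finset.sum_mul_sum]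

theorem lovaszTheta_le_of_equiv [Nonempty X] [Nonempty W] {G : SimpleGraph X} {H : SimpleGraph W}
    (e : X ≃ W) (h : ∀ x y, H.Adj (e x) (e y) → G.Adj x y) : lovaszTheta G ≤ lovaszTheta H := by
  obtain ⟨B, h1, h2, h3, h4⟩ := exists_optimal_lovaszTheta G
  have := sum_le_lovaszTheta (G := H) (h1.submatrix e.symm)
    (by rw [← h2]; exact e.symm.sum_comp fun x => B x x)
    (fun a b hab => h3 _ _ (h _ _ (by simpa using hab)))
  refine le_trans (le_of_eq ?_) this
  rw [← h4, ← e.symm.sum_comp]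
  exact Finset.sum_congr rfl fun x _ => (e.symm.sum_comp _).symm

theorem lovaszTheta_strongPow_le [Nonempty X] (G : SimpleGraph X) (k : ℕ) :
    lovaszTheta (strongPow G k) ≤ lovaszTheta G ^ k := by
  induction k with
  | zero =>
    -- The zeroth power has a single vertex, so the sum of the entries is the trace.
    obtain ⟨B, h1, h2, h3, h4⟩ := exists_optimal_lovaszTheta (strongPow G 0)
    rw [← h4, pow_zero, ← h2]
    simp [Matrix.trace]
  | succ k ih =>
    have : lovaszTheta (strongPow G (k + 1)) ≤ lovaszTheta (strongProd G (strongPow G k)) := by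
      refine lovaszTheta_le_of_equiv (Fin.consEquiv fun _ : Fin (k + 1) => X).symm ?_
      rintro x y ⟨hne, h0, hs⟩
      refine ⟨fun h => hne (by rw [h]), Fin.cases h0 fun i => ?_⟩
      rcases hs with hs | hs
      · exact Or.inl (congrFun hs i)
      · exact hs.2 i
    refine this.trans ?_
    rw [lovaszTheta_strongProd, pow_succ']
    have := one_le_lovaszTheta G
    gcongr

end Theta

/-! ### Square roots, supports and state discrimination. -/

section MatrixLemmas

variable {n 𝕜 : Type*} [RCLike 𝕜] [Fintype n]

theorem Matrix.PosSemidef.exists_isHermitian_sqrt [DecidableEq n] {A : Matrix n n 𝕜}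
    (hA : A.PosSemidef) : ∃ S : Matrix n n 𝕜, Sᴴ = S ∧ S * S = A := by
  open scoped MatrixOrder in
  exact ⟨CFC.sqrt A, (Matrix.nonneg_iff_posSemidef.mp (CFC.sqrt_nonneg A)).1, CFC.sqrt_mul_sqrt_self A hA.nonneg⟩

theorem Matrix.IsHermitian.exists_commuting_pseudoinverse [DecidableEq n] {A : Matrix n n 𝕜}
    (hA : A.IsHermitian) : ∃ S : Matrix n n 𝕜, Sᴴ = S ∧ S * A = A * S ∧ A * S * A = A := by
  have hsa : IsSelfAdjoint A := hA
  have hc : ∀ f : ℝ → ℝ, ContinuousOn f (spectrum ℝ A) := fun f =>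
    (Matrix.finite_real_spectrum (A := A)).continuousOn f
  have hid : cfc (fun x : ℝ => x) A = A := cfc_id' ℝ A
  -- The convention `0⁻¹ = 0` makes this the pseudoinverse; continuity is free on a finite spectrum.
  refine ⟨cfc (fun x : ℝ => x⁻¹) A, cfc_predicate (p := IsSelfAdjoint) (R := ℝ) _ A, ?_, ?_⟩
  · have h := (cfc_commute_cfc (fun x : ℝ => x⁻¹) (fun x : ℝ => x) A).eq
    rwa [hid] at h
  · have h : cfc (fun x : ℝ => x * x⁻¹ * x) A = A * cfc (fun x : ℝ => x⁻¹) A * A := by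
      rw [cfc_mul _ _ A (hc _) (hc _), cfc_mul _ _ A (hc _) (hc _), hid]
    simpa only [mul_inv_mul_cancel, hid] using h.symm

/-- A positive form vanishes only on the kernel, and `P ⊗ₖ Q` sends `N.vec` to the vectorization of
`Q * N * Pᵀ`. -/
theorem Matrix.PosSemidef.mul_mul_eq_zero_of_trace [DecidableEq n] {m : Type*} [Fintype m]
    [DecidableEq m] {P : Matrix n n 𝕜} {Q : Matrix m m 𝕜} (hP : P.PosSemidef) (hQ : Q.PosSemidef)
    {N : Matrix m n 𝕜} (h : star N.vec ⬝ᵥ ((P ⊗ₖ Q) *ᵥ N.vec) = 0) : Q * N * Pᵀ = 0 := by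
  rwa [(hP.kronecker hQ).dotProduct_mulVec_zero_iff, Matrix.kronecker_mulVec_vec,
    Matrix.vec_eq_zero_iff] at h

/-- Mutually orthogonal positive matrices are distinguished without error by a measurement. -/
theorem exists_discriminating_measurement [DecidableEq n] {ι : Type*} [Fintype ι] [Nonempty ι]
    {T : ι → Matrix n n 𝕜} (hT : ∀ i, (T i).IsHermitian) (horth : ∀ i j, i ≠ j → T i * T j = 0) :
    ∃ Q : ι → Matrix n n 𝕜, (∀ i, (Q i).PosSemidef) ∧ ∑ i, Q i = 1 ∧
      ∀ i j, i ≠ j → T i * Q j = 0 := by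
  classical
  obtain ⟨a⟩ := ‹Nonempty ι›
  choose S hS hST hTST using fun i => (hT i).exists_commuting_pseudoinverse
  -- `T i * S i` is the support projection of `T i`; these projections are mutually orthogonal.
  have hH : ∀ i, (T i * S i)ᴴ = T i * S i := fun i => by
    rw [Matrix.conjTranspose_mul, hS, (hT i).eq, hST]
  have hidem : ∀ i, T i * S i * (T i * S i) = T i * S i := fun i => by
    rw [← mul_assoc, hTST]
  have horth' : ∀ i j, i ≠ j → T i * S i * (T j * S j) = 0 := fun i j hij => by
    rw [← hST i, mul_assoc, ← mul_assoc (T i), horth i j hij, zero_mul, mul_zero]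
  have hpos : ∀ A : Matrix n n 𝕜, Aᴴ = A → A * A = A → A.PosSemidef := fun A h1 h2 => by
    have := Matrix.posSemidef_conjTranspose_mul_self A
    rwa [h1, h2] at this
  set E := ∑ k ∈ Finset.univ.erase a, T k * S k with hE
  have hEH : Eᴴ = E := by
    rw [hE, Matrix.conjTranspose_sum]
    exact Finset.sum_congr rfl fun k _ => hH k
  have hEE : E * E = E := by
    rw [hE, Finset.sum_mul_sum]
    refine Finset.sum_congr rfl fun k hk => ?_
    rw [Finset.sum_eq_single k (fun l _ hl => horth' k l hl.symm) (fun h => absurd hk h), hidem]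
  -- The outcome `a` absorbs the complement of all the supports.
  refine ⟨fun i => if i = a then 1 - E else T i * S i, fun i => ?_, ?_, fun i j hij => ?_⟩
  · dsimp only
    split_ifs
    · refine hpos _ (by rw [Matrix.conjTranspose_sub, Matrix.conjTranspose_one, hEH]) ?_
      rw [mul_sub, mul_one, sub_mul, one_mul, hEE, sub_self, sub_zero]
    · exact hpos _ (hH i) (hidem i)
  · rw [← Finset.add_sum_erase _ _ (Finset.mem_univ a), if_pos rfl]
    have : ∑ i ∈ Finset.univ.erase a, (if i = a then 1 - E else T i * S i) = E :=
      Finset.sum_congr rfl fun i hi => if_neg (Finset.ne_of_mem_erase hi)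
    rw [this, sub_add_cancel]
  · dsimp only
    split_ifs with h
    · subst h
      have : T i * E = T i := by
        rw [hE, Finset.mul_sum, Finset.sum_eq_single i]
        · rw [← hST, ← mul_assoc, hTST]
        · intro k _ hk
          rw [← mul_assoc, horth i k hk.symm, zero_mul]
        · intro h; exact absurd (Finset.mem_erase.mpr ⟨hij, Finset.mem_univ _⟩) h
      rw [mul_sub, mul_one, this, sub_self]
    · rw [← mul_assoc, horth i j hij, zero_mul]

end MatrixLemmas

/-! ### Codes in terms of Alice's half, and the theta bound. -/

section GraphCode

variable {X : Type*} [Fintype X]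

/-- Alice's half of an entanglement-assisted zero-error code for messages in `ι`: her reduced state
and her measurements. The steered states of Bob for inputs that are equal or confusable, and
distinct messages, are orthogonal. -/
structure GraphCode (G : SimpleGraph X) (ι n : Type*) [Fintype n] [DecidableEq n] where
  σ : Matrix n n ℂ
  P : ι → X → Matrix n n ℂ
  σ_pos : σ.PosSemidef
  σ_trace : σ.trace = 1
  P_pos : ∀ i x, (P i x).PosSemidef
  P_sum : ∀ i, ∑ x, P i x = 1
  orth : ∀ i j x y, i ≠ j → x = y ∨ G.Adj x y → P i x * σ * P j y = 0

variable {G : SimpleGraph X} {ι n : Type*} [Fintype n] [DecidableEq n]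

/-- Relabelling of the messages, the inputs and the Hilbert space basis. -/
def GraphCode.relabel {W κ l : Type*} [Fintype W] {H : SimpleGraph W} [Fintype l] [DecidableEq l]
    (c : GraphCode G ι n) (f : κ ≃ ι) (e : W ≃ X) (b : l ≃ n)
    (he : ∀ x y, H.Adj x y → G.Adj (e x) (e y)) : GraphCode H κ l where
  σ := c.σ.submatrix b b
  P i x := (c.P (f i) (e x)).submatrix b b
  σ_pos := c.σ_pos.submatrix b
  σ_trace := (b.sum_comp fun i => c.σ i i).trans c.σ_trace
  P_pos i x := (c.P_pos _ _).submatrix b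
  P_sum i := by
    have := congrArg (fun M : Matrix n n ℂ => M.submatrix b b)
      ((e.sum_comp fun x => c.P (f i) x).trans (c.P_sum (f i)))
    ext p q
    simpa [Matrix.sum_apply, Matrix.one_apply] using congrFun (congrFun this p) q
  orth i j x y hij hxy := by
    rw [Matrix.submatrix_mul_equiv, Matrix.submatrix_mul_equiv,
      c.orth _ _ _ _ (f.injective.ne hij) (hxy.imp (congrArg e) (he x y))]
    rfl

/-- The product code. -/
def GraphCode.prod {W κ l : Type*} [Fintype W] {H : SimpleGraph W} [Fintype l] [DecidableEq l]
    (c : GraphCode G ι n) (d : GraphCode H κ l) : GraphCode (strongProd G H) (ι × κ) (n × l) where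
  σ := c.σ ⊗ₖ d.σ
  P i x := c.P i.1 x.1 ⊗ₖ d.P i.2 x.2
  σ_pos := c.σ_pos.kronecker d.σ_pos
  σ_trace := by rw [Matrix.trace_kronecker, c.σ_trace, d.σ_trace, one_mul]
  P_pos i x := (c.P_pos _ _).kronecker (d.P_pos _ _)
  P_sum i := by
    rw [← Matrix.one_kronecker_one, ← c.P_sum i.1, ← d.P_sum i.2, Fintype.sum_prod_type]
    ext ⟨p, q⟩ ⟨r, s⟩
    simp [Matrix.sum_apply, Finset.sum_mul_sum]
  orth i j x y hij hxy := by
    have h : (x.1 = y.1 ∨ G.Adj x.1 y.1) ∧ (x.2 = y.2 ∨ H.Adj x.2 y.2) := by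
      rcases hxy with rfl | h
      · exact ⟨Or.inl rfl, Or.inl rfl⟩
      · exact h.2
    rw [← Matrix.mul_kronecker_mul, ← Matrix.mul_kronecker_mul]
    by_cases h1 : i.1 = j.1
    · have h2 : i.2 ≠ j.2 := fun h2 => hij (Prod.ext h1 h2)
      rw [d.orth _ _ _ _ h2 h.2, Matrix.kronecker_zero]
    · rw [c.orth _ _ _ _ h1 h.1, Matrix.zero_kronecker]

/-- The blocks of the operators `E ↦ U Eₓ U V` for the dilation `V` of a measurement with square
roots `S`, where `U` is the unitary extending `V` and `Eₓ` are the coordinate projections. -/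
def naimarkBlock [DecidableEq X] (S : X → Matrix n n ℂ) (x : X) : Option X → Matrix n n ℂ
  | none => S x * S x
  | some z => (if x = z then S x else 0) - S z * (S x * S x)

theorem sum_naimarkBlock_none [DecidableEq X] {S : X → Matrix n n ℂ} (h : ∑ x, S x * S x = 1) :
    ∑ x, naimarkBlock S x none = 1 := h

theorem sum_naimarkBlock_some [DecidableEq X] {S : X → Matrix n n ℂ} (h : ∑ x, S x * S x = 1)
    (z : X) : ∑ x, naimarkBlock S x (some z) = 0 := by
  simp [naimarkBlock, Finset.sum_sub_distrib, ← Finset.mul_sum, h]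

/-- With `V` the isometry of components `S z`, the blocks form the first column of `U Eₓ U` for the
self-adjoint unitary `U = [[0, V*], [V, 1 - V V*]]`. The `U Eₓ U` are orthogonal projections with
corner `S x * S x`. -/
theorem sum_naimarkBlock_mul [DecidableEq X] {S : X → Matrix n n ℂ} (hS : ∀ x, (S x)ᴴ = S x)
    (h : ∑ x, S x * S x = 1) (x y : X) :
    ∑ o, (naimarkBlock S x o)ᴴ * naimarkBlock S y o = if x = y then S x * S x else 0 := by
  have hz : ∀ z, (naimarkBlock S x (some z))ᴴ * naimarkBlock S y (some z) =
      (if x = z then (if y = z then S x * S y else 0) else 0)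
      - (if x = z then S x * S z * (S y * S y) else 0)
      - (if y = z then S x * S x * (S z * S y) else 0)
      + S x * S x * (S z * S z) * (S y * S y) := fun z => by
    simp only [naimarkBlock, Matrix.conjTranspose_sub, Matrix.conjTranspose_mul, hS,
      apply_ite Matrix.conjTranspose, Matrix.conjTranspose_zero]
    split_ifs <;> noncomm_ring
  rw [Fintype.sum_option, Finset.sum_congr rfl fun z _ => hz z, Finset.sum_add_distrib,
    Finset.sum_sub_distrib, Finset.sum_sub_distrib, ← Finset.sum_mul, ← Finset.mul_sum, h]
  simp only [Finset.sum_ite_eq, Finset.mem_univ, if_true, naimarkBlock, Matrix.conjTranspose_mul, hS]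
  by_cases hxy : x = y
  · subst hxy; simp only [if_true]; noncomm_ring
  · simp only [hxy, Ne.symm hxy, if_false]; noncomm_ring

-- Every block has the form `C * S x`, so orthogonality of the code survives the dilation.
omit [Fintype X] in
theorem naimarkBlock_mul_mul_eq_zero [DecidableEq X] {S R : X → Matrix n n ℂ}
    (hR : ∀ x, (R x)ᴴ = R x) {σ : Matrix n n ℂ} {x y : X} (h : S y * σ * R x = 0) (o : Option X) :
    naimarkBlock S y o * σ * (naimarkBlock R x o)ᴴ = 0 := by
  have h1 : ∀ (S : X → Matrix n n ℂ) (x : X) (o : Option X), ∃ C, naimarkBlock S x o = C * S x := by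
    rintro S x (_ | z)
    · exact ⟨S x, rfl⟩
    · refine ⟨(if x = z then 1 else 0) - S z * S x, ?_⟩
      simp only [naimarkBlock]
      split_ifs <;> noncomm_ring
  obtain ⟨C, hC⟩ := h1 S y o
  obtain ⟨D, hD⟩ := h1 R x o
  calc naimarkBlock S y o * σ * (naimarkBlock R x o)ᴴ = C * (S y * σ * R x) * Dᴴ := by
        rw [hC, hD, Matrix.conjTranspose_mul, hR]; noncomm_ring
    _ = 0 := by rw [h]; simp

theorem Matrix.PosSemidef.map_re {Z : Matrix X X ℂ} (hZ : Z.PosSemidef) :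
    (Z.map Complex.re).PosSemidef := by
  rw [posSemidef_real_iff]
  refine ⟨fun x y => ?_, fun v => ?_⟩
  · rw [Matrix.map_apply, Matrix.map_apply, ← hZ.1.apply x y]; simp
  · have := (Complex.le_def.mp
      ((Matrix.posSemidef_iff_dotProduct_mulVec.mp hZ).2 fun x => (v x : ℂ))).1
    simpa [dotProduct, Matrix.mulVec, Finset.mul_sum, mul_assoc] using this

/-- The factors cancel one side at a time, since `Aᴴ * A = 0` or `A * Aᴴ = 0` forces `A = 0`. -/
theorem mul_mul_eq_zero_of_sq {S R σ : Matrix n n ℂ} (hS : Sᴴ = S) (hR : Rᴴ = R)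
    (h : S * S * σ * (R * R) = 0) : S * σ * R = 0 := by
  have h1 : S * (σ * (R * R)) = 0 := by
    rw [← Matrix.conjTranspose_mul_self_eq_zero, Matrix.conjTranspose_mul, hS]
    calc (σ * (R * R))ᴴ * S * (S * (σ * (R * R))) = (σ * (R * R))ᴴ * (S * S * σ * (R * R)) := by
          noncomm_ring
      _ = 0 := by rw [h, mul_zero]
  rw [← Matrix.self_mul_conjTranspose_eq_zero, Matrix.conjTranspose_mul, hR]
  calc S * σ * R * (R * (S * σ)ᴴ) = S * (σ * (R * R)) * (S * σ)ᴴ := by noncomm_ring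
    _ = 0 := by rw [h1, zero_mul]

theorem GraphCode.card_le_lovaszTheta [Nonempty X] [Fintype ι] [Nonempty ι]
    (c : GraphCode G ι n) : (Fintype.card ι : ℝ) ≤ lovaszTheta G := by
  classical
  choose S hS hSP using fun i x => (c.P_pos i x).exists_isHermitian_sqrt
  have hsum : ∀ i, ∑ x, S i x * S i x = 1 := fun i => by simp only [hSP, c.P_sum]
  obtain ⟨N, hN⟩ := c.σ_pos.exists_eq_conjTranspose_mul
  let w : X → Option X → Matrix n n ℂ := fun x o => ∑ i, naimarkBlock (S i) x o
  -- Column `x` is the vector attached to `x`: the blocks summed over messages, applied to the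
  -- purification `Nᴴ` of `σ`.
  let C : Matrix (Option X × n × n) X ℂ := Matrix.of fun p x => (w x p.1 * Nᴴ) p.2.1 p.2.2
  have hZ : ∀ x y, (Cᴴ * C) x y = ∑ o, ((w x o)ᴴ * w y o * c.σ).trace := by
    intro x y
    rw [Matrix.mul_apply, Fintype.sum_prod_type]
    refine Finset.sum_congr rfl fun o _ => ?_
    have : ((w x o)ᴴ * w y o * c.σ).trace = ((w x o * Nᴴ)ᴴ * (w y o * Nᴴ)).trace := by
      rw [hN, ← mul_assoc, Matrix.trace_mul_comm, Matrix.conjTranspose_mul,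
        Matrix.conjTranspose_conjTranspose]
      simp only [mul_assoc]
    rw [this, Matrix.trace, Fintype.sum_prod_type, Finset.sum_comm]
    refine Finset.sum_congr rfl fun p _ => ?_
    rw [Matrix.diag_apply, Matrix.mul_apply]
    rfl
  have hconf : ∀ x y, x = y ∨ G.Adj x y →
      (Cᴴ * C) x y = if x = y then ∑ i, (c.P i x * c.σ).trace else 0 := by
    intro x y hxy
    have hij : ∀ o, ((w x o)ᴴ * w y o * c.σ).trace =
        ∑ i, ((naimarkBlock (S i) x o)ᴴ * naimarkBlock (S i) y o * c.σ).trace := by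
      intro o
      simp only [w, Matrix.conjTranspose_sum, Finset.sum_mul]
      simp only [Finset.mul_sum, Finset.sum_mul, Matrix.trace_sum]
      refine Finset.sum_congr rfl fun i _ => Finset.sum_eq_single i (fun j _ hji => ?_) (by simp)
      rw [mul_assoc, Matrix.trace_mul_comm, naimarkBlock_mul_mul_eq_zero (hS i), Matrix.trace_zero]
      refine mul_mul_eq_zero_of_sq (hS j y) (hS i x) ?_
      rw [hSP, hSP]
      exact c.orth j i y x hji (hxy.imp Eq.symm fun h => h.symm)
    rw [hZ, Finset.sum_congr rfl fun o _ => hij o, Finset.sum_comm]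
    have : ∀ i, ∑ o, ((naimarkBlock (S i) x o)ᴴ * naimarkBlock (S i) y o * c.σ).trace =
        if x = y then (c.P i x * c.σ).trace else 0 := fun i => by
      rw [← Matrix.trace_sum, ← Finset.sum_mul, sum_naimarkBlock_mul (hS i) (hsum i), hSP]
      split_ifs <;> simp
    rw [Finset.sum_congr rfl fun i _ => this i]
    split_ifs <;> simp
  have htrace : ∑ x, (Cᴴ * C) x x = Fintype.card ι := by
    rw [Finset.sum_congr rfl fun x _ => (hconf x x (Or.inl rfl)).trans (if_pos rfl),
      Finset.sum_comm]
    have : ∀ i, ∑ x, (c.P i x * c.σ).trace = 1 := fun i => by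
      rw [← Matrix.trace_sum, ← Finset.sum_mul, c.P_sum, one_mul, c.σ_trace]
    simp [this]
  -- Summed over inputs, each dilated measurement is the identity on the original space, so only the
  -- `none` block survives.
  have htotal : ∑ x, ∑ y, (Cᴴ * C) x y = (Fintype.card ι : ℂ) ^ 2 := by
    have hw : ∀ o, ∑ x, w x o = match o with
        | none => (Fintype.card ι : Matrix n n ℂ)
        | some _ => 0 := by
      rintro (_ | z)
      · simp only [w]
        rw [Finset.sum_comm, Finset.sum_congr rfl fun i _ => sum_naimarkBlock_none (hsum i)]
        simp
      · simp only [w]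
        rw [Finset.sum_comm, Finset.sum_congr rfl fun i _ => sum_naimarkBlock_some (hsum i) z]
        simp
    have : ∑ x, ∑ y, (Cᴴ * C) x y = ∑ o, ((∑ x, w x o)ᴴ * (∑ y, w y o) * c.σ).trace := by
      simp only [hZ, Matrix.conjTranspose_sum, Finset.sum_mul]
      simp only [Finset.mul_sum, Finset.sum_mul, Matrix.trace_sum]
      rw [Finset.sum_congr rfl fun x _ => Finset.sum_comm, Finset.sum_comm]
    rw [this, Fintype.sum_option]
    simp only [hw]
    simp only [Matrix.conjTranspose_natCast, zero_mul, mul_zero, Matrix.trace_zero,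
      Finset.sum_const_zero, add_zero]
    rw [← Nat.cast_mul, ← nsmul_eq_mul, Matrix.trace_smul, c.σ_trace]
    simp [sq]
  have hm : (0 : ℝ) < Fintype.card ι := by exact_mod_cast Fintype.card_pos
  have := sum_le_lovaszTheta (G := G) (B := (Fintype.card ι : ℝ)⁻¹ • (Cᴴ * C).map Complex.re)
    ((Matrix.posSemidef_conjTranspose_mul_self C).map_re.smul (inv_nonneg.mpr hm.le))
    (by
      rw [Matrix.trace_smul]
      have h : ((Cᴴ * C).map Complex.re).trace = Fintype.card ι := by
        have := congrArg Complex.re htrace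
        simpa [Matrix.trace] using this
      rw [h, smul_eq_mul, inv_mul_cancel₀ hm.ne'])
    (fun x y hxy => by simp [Matrix.smul_apply, hconf x y (Or.inr hxy), hxy.ne])
  refine le_trans (le_of_eq ?_) this
  have h : ∑ x, ∑ y, ((Cᴴ * C) x y).re = (Fintype.card ι : ℝ) ^ 2 := by
    have := congrArg Complex.re htotal
    simp only [Complex.re_sum] at this
    rw [this, ← Nat.cast_pow, Complex.natCast_re, Nat.cast_pow]
  simp only [Matrix.smul_apply, Matrix.map_apply, smul_eq_mul, ← Finset.mul_sum, h]
  field_simp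

end GraphCode

/-! ### Channels, confusability and capacity. -/

section Capacity

variable {X Y : Type*} [Fintype X] {G : SimpleGraph X} {R : X → Y → Prop}

/-- The numbers of messages of the entanglement-assisted zero-error codes for a graph. -/
def graphCodeSizes (G : SimpleGraph X) : Set ℕ :=
  {m | 0 < m ∧ ∃ d : ℕ, Nonempty (GraphCode G (Fin m) (Fin d))}

/-- `G` is the confusability graph of a channel with input–output relation `R`. -/
def IsConfusability (R : X → Y → Prop) (G : SimpleGraph X) : Prop :=
  ∀ x x', (x = x' ∨ G.Adj x x') ↔ ∃ y, R x y ∧ R x' y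

omit [Fintype X] in
theorem isConfusability_edgeOutputs (G : SimpleGraph X) : IsConfusability (edgeOutputs G) G := by
  intro x x'
  constructor
  · rintro (rfl | h)
    · by_cases hx : ∀ z, ¬ G.Adj x z
      · exact ⟨Sum.inr ⟨x, hx⟩, rfl, rfl⟩
      · push Not at hx
        obtain ⟨z, hz⟩ := hx
        exact ⟨Sum.inl ⟨s(x, z), hz⟩, Sym2.mem_mk_left x z, Sym2.mem_mk_left x z⟩
    · exact ⟨Sum.inl ⟨s(x, x'), h⟩, Sym2.mem_mk_left x x', Sym2.mem_mk_right x x'⟩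
  · rintro ⟨⟨e, he⟩ | ⟨v, hv⟩, h1, h2⟩
    · by_cases hxx : x = x'
      · exact Or.inl hxx
      · refine Or.inr ?_
        have h1 : x ∈ e := h1
        have h2 : x' ∈ e := h2
        rw [(Sym2.mem_and_mem_iff hxx).mp ⟨h1, h2⟩] at he
        exact he
    · have h1 : x = v := h1
      have h2 : x' = v := h2
      exact Or.inl (h1.trans h2.symm)

omit [Fintype X] in
theorem isConfusability_channelOutputs {N : X → PMF Y} :
    IsConfusability (channelOutputs N) (confusabilityGraph N) := by
  intro x x'
  constructor
  · rintro (rfl | h)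
    · obtain ⟨y, hy⟩ := (N x).support_nonempty
      have hy : N x y ≠ 0 := (N x).mem_support_iff y |>.mp hy
      exact ⟨y, hy, hy⟩
    · exact h.2
  · intro h
    by_cases hx : x = x'
    · exact Or.inl hx
    · exact Or.inr ⟨hx, h⟩

-- A confusing output for words is a choice of confusing outputs for the letters.
omit [Fintype X] in
theorem isConfusability_channelPow {N : X → PMF Y} (h : IsConfusability (channelOutputs N) G)
    (k : ℕ) : IsConfusability (channelOutputs (channelPow N k)) (strongPow G k) := by
  intro x x'
  have hout : ∀ (x : Fin k → X) y, channelOutputs (channelPow N k) x y ↔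
      ∀ i, channelOutputs N (x i) (y i) := fun x y => by
    change ∏ i, N (x i) (y i) ≠ 0 ↔ _
    simp [Finset.prod_ne_zero_iff, channelOutputs]
  simp only [hout, ← forall_and]
  rw [← Classical.skolem (p := fun i y => channelOutputs N (x i) y ∧ channelOutputs N (x' i) y)]
  rw [← forall_congr' fun i => h (x i) (x' i)]
  constructor
  · rintro (rfl | h)
    · exact fun i => Or.inl rfl
    · exact h.2
  · intro h
    by_cases hx : x = x'
    · exact Or.inl hx
    · exact Or.inr ⟨hx, h⟩

/-- With `ψ` read as a matrix `N`, zero error says that `Q y i` fixes `N * (P i x)ᵀ` and kills `N *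
(P j x')ᵀ` when both inputs can yield `y`. Inserting `Q y i` between the two shows that they are
orthogonal. -/
theorem EAProtocol.graphCode {m : ℕ} (hR : IsConfusability R G) (p : EAProtocol R m) :
    Nonempty (GraphCode G (Fin m) (Fin p.dA)) := by
  let N : Matrix (Fin p.dB) (Fin p.dA) ℂ := Matrix.of fun b a => p.ψ (a, b)
  have hN : N.vec = p.ψ := rfl
  have hzero : ∀ i x y j, R x y → i ≠ j → p.Q y j * N * (p.P i x)ᵀ = 0 := fun i x y j h hij =>
    (p.P_pos i x).mul_mul_eq_zero_of_trace (p.Q_pos y j) (hN ▸ p.zero_error i x y j h hij)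
  have hfix : ∀ i x y, R x y → p.Q y i * N * (p.P i x)ᵀ = N * (p.P i x)ᵀ := fun i x y h => by
    conv_rhs => rw [← Matrix.one_mul N, ← p.Q_sum y, Matrix.sum_mul, Matrix.sum_mul]
    rw [Finset.sum_eq_single i (fun j _ hj => hzero i x y j h hj.symm) (by simp)]
  refine ⟨⟨Nᴴ * N, fun i x => (p.P i x)ᵀ, Matrix.posSemidef_conjTranspose_mul_self N, ?_,
    fun i x => (p.P_pos i x).transpose, fun i => ?_, fun i j x x' hij hxx => ?_⟩⟩
  · rw [← Matrix.star_vec_dotProduct_vec, hN, p.unit]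
  · rw [← Matrix.transpose_sum, p.P_sum, Matrix.transpose_one]
  · obtain ⟨y, hy, hy'⟩ := (hR x x').mp hxx
    have h1 : (p.P i x)ᵀ * Nᴴ = (p.P i x)ᵀ * Nᴴ * p.Q y i := by
      have := congrArg Matrix.conjTranspose (hfix i x y hy)
      simp only [Matrix.conjTranspose_mul, (p.P_pos i x).transpose.1.eq, (p.Q_pos y i).1.eq] at this
      rw [Matrix.mul_assoc, this]
    calc (p.P i x)ᵀ * (Nᴴ * N) * (p.P j x')ᵀ = (p.P i x)ᵀ * Nᴴ * (N * (p.P j x')ᵀ) := by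
          simp only [Matrix.mul_assoc]
      _ = (p.P i x)ᵀ * Nᴴ * (p.Q y i * N * (p.P j x')ᵀ) := by
          conv_lhs => rw [h1]
          simp only [Matrix.mul_assoc]
      _ = 0 := by rw [hzero j x' y i hy' hij.symm, Matrix.mul_zero]

/-- An empty measurement sums to the identity only in dimension zero, where there is no unit vector.
-/
theorem EAProtocol.size_pos {m : ℕ} (p : EAProtocol R m) (y : Y) : 0 < m := by
  rcases Nat.eq_zero_or_pos m with rfl | h
  · exfalso
    have h1 : (0 : Matrix (Fin p.dB) (Fin p.dB) ℂ) = 1 := by simpa using p.Q_sum y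
    have hψ : p.ψ = 0 := by
      ext ⟨a, b⟩
      have := congrFun (congrFun h1 b) b
      simp at this
    have := p.unit
    simp [hψ] at this
  · exact h

theorem GraphCode.protocol {m d : ℕ} (hm : 0 < m) (hR : IsConfusability R G)
    (c : GraphCode G (Fin m) (Fin d)) : Nonempty (EAProtocol R m) := by
  classical
  have : Nonempty (Fin m) := ⟨⟨0, hm⟩⟩
  obtain ⟨N, hN⟩ := c.σ_pos.exists_eq_conjTranspose_mul
  -- Bob's unnormalised state for message `j`, summed over the inputs compatible with `y`; his
  -- measurement discriminates these.
  let T : Y → Fin m → Matrix (Fin d) (Fin d) ℂ := fun y j =>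
    ∑ x with R x y, N * c.P j x * Nᴴ
  have hpos : ∀ j x, (N * c.P j x * Nᴴ).PosSemidef := fun j x =>
    (c.P_pos j x).mul_mul_conjTranspose_same N
  have horth : ∀ y i j, i ≠ j → T y i * T y j = 0 := by
    intro y i j hij
    simp only [T, Finset.sum_mul_sum]
    refine Finset.sum_eq_zero fun x hx => Finset.sum_eq_zero fun x' hx' => ?_
    have h := c.orth i j x x' hij
      ((hR x x').mpr ⟨y, (Finset.mem_filter.mp hx).2, (Finset.mem_filter.mp hx').2⟩)
    calc N * c.P i x * Nᴴ * (N * c.P j x' * Nᴴ) = N * (c.P i x * c.σ * c.P j x') * Nᴴ := by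
          rw [hN]; simp only [mul_assoc]
      _ = 0 := by rw [h]; simp
  choose Q hQ hQs hQT using fun y => exists_discriminating_measurement
    (T := T y) (fun j => (Matrix.posSemidef_sum _ fun x _ => hpos j x).1) (horth y)
  refine ⟨⟨d, d, N.vec, fun i x => (c.P i x)ᵀ, Q, ?_, fun i x => (c.P_pos i x).transpose,
    fun i => ?_, hQ, hQs, fun i x y j hxy hij => ?_⟩⟩
  · rw [Matrix.star_vec_dotProduct_vec, ← hN, c.σ_trace]
  · rw [← Matrix.transpose_sum, c.P_sum, Matrix.transpose_one]
  · rw [Matrix.kronecker_mulVec_vec, Matrix.star_vec_dotProduct_vec, Matrix.transpose_transpose]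
    have hcyc : ∀ x, (Nᴴ * (Q y j * N * c.P i x)).trace = (N * c.P i x * Nᴴ * Q y j).trace :=
      fun x => by
        rw [Matrix.trace_mul_comm, mul_assoc, mul_assoc, Matrix.trace_mul_comm]
        simp only [mul_assoc]
    obtain ⟨S, hS⟩ := (hQ y j).exists_eq_conjTranspose_mul
    have hnn : ∀ x, 0 ≤ (N * c.P i x * Nᴴ * Q y j).trace := fun x => by
      rw [hS, ← mul_assoc, Matrix.trace_mul_comm, ← mul_assoc]
      exact ((hpos i x).mul_mul_conjTranspose_same S).trace_nonneg
    have hsum : ∑ x with R x y, (N * c.P i x * Nᴴ * Q y j).trace = 0 := by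
      rw [← Matrix.trace_sum, ← Finset.sum_mul, hQT y i j hij, Matrix.trace_zero]
    rw [hcyc]
    exact (Finset.sum_eq_zero_iff_of_nonneg fun x _ => hnn x).mp hsum x (by simpa using hxy)

/-- The right side mentions only `G`, so all channels with the same confusability graph have the
same sizes. Positivity is imposed there because a code with no messages exists vacuously. -/
theorem eaSizes_eq [Nonempty X] (hR : IsConfusability R G) : eaSizes R = graphCodeSizes G := by
  ext m
  constructor
  · rintro ⟨p⟩
    obtain ⟨x⟩ := ‹Nonempty X›
    obtain ⟨y, -⟩ := (hR x x).mp (Or.inl rfl)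
    exact ⟨p.size_pos y, p.dA, p.graphCode hR⟩
  · rintro ⟨hm, d, ⟨c⟩⟩
    exact c.protocol hm hR

theorem one_mem_graphCodeSizes [Nonempty X] (G : SimpleGraph X) : 1 ∈ graphCodeSizes G := by
  classical
  obtain ⟨a⟩ := ‹Nonempty X›
  refine ⟨one_pos, 1, ⟨⟨1, fun _ x => if x = a then 1 else 0, .one, by simp, fun i x => ?_,
    fun i => by simp, fun i j x y hij => absurd (Subsingleton.elim i j) hij⟩⟩⟩
  split_ifs
  · exact .one
  · exact .zero

theorem le_lovaszTheta_of_mem_graphCodeSizes [Nonempty X] {m : ℕ} (hm : m ∈ graphCodeSizes G) :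
    (m : ℝ) ≤ lovaszTheta G := by
  obtain ⟨hm, d, ⟨c⟩⟩ := hm
  have : Nonempty (Fin m) := ⟨⟨0, hm⟩⟩
  simpa using c.card_le_lovaszTheta

theorem isGreatest_eaNumber [Nonempty X] (hR : IsConfusability R G) :
    IsGreatest (eaSizes R) (eaNumber R) := by
  have hbdd : BddAbove (eaSizes R) := ⟨⌊lovaszTheta G⌋₊, fun m hm =>
    Nat.le_floor (le_lovaszTheta_of_mem_graphCodeSizes (eaSizes_eq hR ▸ hm))⟩
  exact ⟨Nat.sSup_mem ⟨1, eaSizes_eq hR ▸ one_mem_graphCodeSizes G⟩ hbdd,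
    fun m hm => le_csSup hbdd hm⟩

theorem eaNumber_le_lovaszTheta [Nonempty X] (hR : IsConfusability R G) :
    (eaNumber R : ℝ) ≤ lovaszTheta G :=
  le_lovaszTheta_of_mem_graphCodeSizes (eaSizes_eq hR ▸ (isGreatest_eaNumber hR).1)

theorem eaNumber_eq_alphaStar [Nonempty X] (hR : IsConfusability R G) :
    eaNumber R = alphaStar G := by
  rw [alphaStar, eaNumber, eaNumber, eaSizes_eq hR, eaSizes_eq (isConfusability_edgeOutputs G)]

theorem isGreatest_alphaStar [Nonempty X] (G : SimpleGraph X) :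
    IsGreatest (graphCodeSizes G) (alphaStar G) := by
  rw [← eaSizes_eq (isConfusability_edgeOutputs G)]
  exact isGreatest_eaNumber (isConfusability_edgeOutputs G)

/-- The product code works: words adjacent in the power `k + l` split into halves that are each
equal or adjacent. -/
theorem alphaStar_mul_le_strongPow_add [Nonempty X] (G : SimpleGraph X) (k l : ℕ) :
    alphaStar (strongPow G k) * alphaStar (strongPow G l) ≤ alphaStar (strongPow G (k + l)) := by
  obtain ⟨hm, d, ⟨c⟩⟩ := (isGreatest_alphaStar (strongPow G k)).1
  obtain ⟨hm', d', ⟨c'⟩⟩ := (isGreatest_alphaStar (strongPow G l)).1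
  refine (isGreatest_alphaStar _).2 ⟨Nat.mul_pos hm hm', d * d', ⟨(c.prod c').relabel
    finProdFinEquiv.symm (Fin.appendEquiv k l).symm finProdFinEquiv.symm ?_⟩⟩
  rintro x y ⟨hne, h⟩
  exact ⟨(Fin.appendEquiv k l).symm.injective.ne hne,
    or_iff_not_imp_left.mpr fun hn => ⟨hn, fun i => h _⟩,
    or_iff_not_imp_left.mpr fun hn => ⟨hn, fun i => h _⟩⟩

theorem exists_isRate_alphaStar [Nonempty X] (G : SimpleGraph X) :
    ∃ C : ℝ, IsRate (fun k => alphaStar (strongPow G k)) C ∧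
      C ≤ Real.logb 2 (lovaszTheta G) := by
  set a : ℕ → ℕ := fun k => alphaStar (strongPow G k) with ha
  have hpos : ∀ k, (0 : ℝ) < a k := fun k => by
    exact_mod_cast (isGreatest_alphaStar (strongPow G k)).1.1
  have hsub : Subadditive fun k => - Real.logb 2 (a k) := fun k l => by
    have h : (a k * a l : ℝ) ≤ a (k + l) := by exact_mod_cast alphaStar_mul_le_strongPow_add G k l
    have := Real.logb_le_logb_of_le one_lt_two (mul_pos (hpos k) (hpos l)) h
    rw [Real.logb_mul (hpos k).ne' (hpos l).ne'] at this
    dsimp only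
    linarith
  have hle : ∀ k, Real.logb 2 (a k) ≤ k * Real.logb 2 (lovaszTheta G) := fun k => by
    rw [← Real.logb_pow]
    refine Real.logb_le_logb_of_le one_lt_two (hpos k) ?_
    exact (eaNumber_le_lovaszTheta (isConfusability_edgeOutputs _)).trans
      (lovaszTheta_strongPow_le G k)
  have hθ : 0 ≤ Real.logb 2 (lovaszTheta G) :=
    Real.logb_nonneg one_lt_two (one_le_lovaszTheta G)
  have hrate : ∀ k : ℕ, 1 / (k : ℝ) * Real.logb 2 (a k) ≤ Real.logb 2 (lovaszTheta G) := fun k => by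
    rcases Nat.eq_zero_or_pos k with rfl | hk
    -- At `k = 0` the rate is `0` by the convention `1 / 0 = 0`.
    · simpa using hθ
    · have hk' : (0 : ℝ) < k := by exact_mod_cast hk
      rw [one_div, inv_mul_le_iff₀ hk']
      exact hle k
  have hlim := (hsub.tendsto_lim ⟨- Real.logb 2 (lovaszTheta G), by
    rintro _ ⟨k, rfl⟩
    have := hrate k
    dsimp only
    rw [neg_div, neg_le_neg_iff]
    rwa [one_div_mul_eq_div] at this⟩).neg
  have hlim' : IsRate a (- hsub.lim) := by
    refine hlim.congr fun k => ?_
    ring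
  exact ⟨_, hlim', le_of_tendsto' hlim' hrate⟩

end Capacity

theorem theorem1 {X : Type*} [Fintype X] [Nonempty X] (G : SimpleGraph X) :
    -- the two maxima that define `ϑ(G)` and `α*(G)` are attained, and `α*(G) ≤ ϑ(G)`
    IsGreatest (thetaValues G) (lovaszTheta G) ∧
    IsGreatest (eaSizes (edgeOutputs G)) (alphaStar G) ∧
    (alphaStar G : ℝ) ≤ lovaszTheta G ∧
    -- `ϑ` is multiplicative
    (∀ (W : Type*) [Fintype W] [Nonempty W] (H : SimpleGraph W),
      lovaszTheta (strongProd G H) = lovaszTheta G * lovaszTheta H) ∧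
    -- the entanglement-assisted zero-error capacity of `G` exists and is at most `log ϑ(G)`
    (∃ C : ℝ, IsRate (fun k => alphaStar (strongPow G k)) C ∧
      C ≤ Real.logb 2 (lovaszTheta G)) ∧
    -- the same for every channel with confusability graph `G`
    (∀ (Y : Type*) (N : X → PMF Y), confusabilityGraph N = G →
      IsGreatest (eaSizes (channelOutputs N)) (channelAlphaStar N) ∧
      (channelAlphaStar N : ℝ) ≤ lovaszTheta G ∧
      ∃ C : ℝ, IsRate (fun k => channelAlphaStar (channelPow N k)) C ∧
        C ≤ Real.logb 2 (lovaszTheta G)) := by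
  refine ⟨isGreatest_lovaszTheta G, isGreatest_eaNumber (isConfusability_edgeOutputs G),
    eaNumber_le_lovaszTheta (isConfusability_edgeOutputs G),
    fun W _ _ H => lovaszTheta_strongProd G H, exists_isRate_alphaStar G, ?_⟩
  rintro Y N rfl
  have hN := isConfusability_channelOutputs (N := N)
  refine ⟨isGreatest_eaNumber hN, eaNumber_le_lovaszTheta hN, ?_⟩
  have : (fun k => channelAlphaStar (channelPow N k)) =
      fun k => alphaStar (strongPow (confusabilityGraph N) k) :=
    funext fun k => eaNumber_eq_alphaStar (isConfusability_channelPow hN k)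
  rw [this]
  exact exists_isRate_alphaStar _
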